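/- Let $0\le p\le n$ and let $\operatorname{Gr}_{n,p}=\{P\in\mathbb R^{n\times n}: P^T=P,\ P^2=P,\ \operatorname{rank}P=p\}$ be the Grassmann manifold, a Riemannian submanifold of the space of symmetric matrices with tangent spaces $T_P\operatorname{Gr}_{n,p}=\{X: X^T=X,\ PX+XP=X\}$ and canonical metric $\langle X,Y\rangle_P=\kappa\operatorname{tr}(X^TY)$, where $\kappa>0$ is a fixed normalization constant (e.g. $\kappa=\tfrac12$ or $\kappa=1$). Let $\operatorname{Exp}$ be its exponential map, and let $I=I_{n,p}=\operatorname{diag}(1,\dots,1,0,\dots,0)$ ($p$ ones). For $P,Q\in \operatorname{Gr}_{n,p}$ not in each other's cut locus (equivalently, on $\operatorname{Gr}_{n,p}$: joined by exactly one shortest geodesic), let $\operatorname{Log}_P(Q)\in T_P\operatorname{Gr}_{n,p}$ be the initial velocity of the unique shortest geodesic $[0,1]\to\operatorname{Gr}_{n,p}$ from $P$ to $Q$, and let $\mathcal T_{P\to Q}$ be the (Levi-Civita) parallel transport along it. Put $$P\oplus_{gr}Q=\operatorname{Exp}_P\big(\mathcal T_{I\to P}(\operatorname{Log}_I(Q))\big),\qquad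 \ominus_{gr}P=\operatorname{Exp}_I(-\operatorname{Log}_I(P)),$$ $$\langle P,Q\rangle=\langle\operatorname{Log}_I(P),\operatorname{Log}_I(Q)\rangle_I,\qquad \|P\|=\sqrt{\langle P,P\rangle},\qquad d(P,Q)=\|\ominus_{gr}P\oplus_{gr}Q\| ,$$ where $d(P,Q)$ is defined when none of $P$, $Q$, $\ominus_{gr}P\oplus_{gr}Q$ is in the cut locus of $I$. **Theorem.** (i) For every $P\in\operatorname{Gr}_{n,p}$ not in the cut locus of $I$, the point $\ominus_{gr}P$ is not in the cut locus of $I$ either, and it is the unique such point $X$ with $X\oplus_{gr}P=I$. (ii) The Grassmann inverse map $\lambda(P)=\ominus_{gr}P$ is a Grassmann gyroisometry: for all $P,Q\in\operatorname{Gr}_{n,p}$ for which $d(P,Q)$ is defined, $d(\lambda(P),\lambda(Q))$ is defined as well and $$d(\lambda(P),\lambda(Q))=d(P,Q).$$ -/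

import Mathlib

open scoped Matrix

/-- The Grassmann manifold `Gr_{n,p}` from the projector perspective: a `p`-dimensional subspace of
`ℝⁿ` is represented by the orthogonal projector onto it, a symmetric idempotent of rank `p`. -/
def Gr (n p : ℕ) : Type :=
  {P : Matrix (Fin n) (Fin n) ℝ // Pᵀ = P ∧ P * P = P ∧ P.rank = p}

namespace Gr

variable {n p : ℕ}

/-- The projection matrix representing a point of `Gr n p`. -/
def mat (P : Gr n p) : Matrix (Fin n) (Fin n) ℝ := P.1

/-- The identity element `I_{n,p} = diag(1, …, 1, 0, …, 0)` (with `p` ones) of `Gr_{n,p}`. -/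
def base (hp : p ≤ n) : Gr n p :=
  ⟨Matrix.diagonal fun i : Fin n => if (i : ℕ) < p then (1 : ℝ) else 0, by
    refine ⟨Matrix.diagonal_transpose _, ?_, ?_⟩
    · rw [Matrix.diagonal_mul_diagonal]
      congr 1
      funext i
      split_ifs <;> simp
    · rw [Matrix.rank_diagonal]
      have e : {i : Fin n // (if (i : ℕ) < p then (1 : ℝ) else 0) ≠ 0} ≃ Fin p :=
        { toFun := fun i => ⟨i.1, by
            by_contra h
            exact i.2 (if_neg h)⟩
          invFun := fun j => ⟨⟨j.1, lt_of_lt_of_le j.2 hp⟩, by simp⟩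
          left_inv := fun i => by ext; rfl
          right_inv := fun j => by ext; rfl }
      rw [Fintype.card_congr e, Fintype.card_fin]⟩

/-- The tangent space `T_P Gr_{n,p}`, as a subspace of the symmetric matrices:
`{X | Xᵀ = X, P X + X P = X}`. -/
def tangent (P : Gr n p) : Submodule ℝ (Matrix (Fin n) (Fin n) ℝ) where
  carrier := {X | Xᵀ = X ∧ P.mat * X + X * P.mat = X}
  zero_mem' := by simp
  add_mem' := by
    rintro X Y ⟨hX, hX'⟩ ⟨hY, hY'⟩
    refine ⟨by rw [Matrix.transpose_add, hX, hY], ?_⟩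
    nth_rewrite 3 [← hX']
    nth_rewrite 3 [← hY']
    rw [mul_add, add_mul]
    abel
  smul_mem' := by
    rintro c X ⟨hX, hX'⟩
    refine ⟨by rw [Matrix.transpose_smul, hX], ?_⟩
    rw [Matrix.mul_smul, Matrix.smul_mul, ← smul_add, hX']

/-- The canonical (orthogonally invariant) Riemannian metric of `Gr_{n,p}`,
`⟨X, Y⟩_P = κ tr(Xᵀ Y)` on every tangent space. The positive constant `κ` fixes the
normalization: `κ = 1/2` and `κ = 1` (Frobenius) are both in use. -/
noncomputable def metric (κ : ℝ) (X Y : Matrix (Fin n) (Fin n) ℝ) : ℝ :=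
  κ * (Xᵀ * Y).trace

/-- `V` is a parallel vector field along the curve `γ`: it is tangent, differentiable, and its
covariant derivative vanishes. The Levi-Civita covariant derivative of a submanifold of a Euclidean
space is the tangential part of the ordinary derivative, so the condition is that the derivative of
`V` is orthogonal to the tangent space. (Orthogonality does not depend on `κ`; we take `κ = 1`.) -/
def IsParallelAlong (γ : ℝ → Gr n p) (V : ℝ → Matrix (Fin n) (Fin n) ℝ) : Prop :=
  (∀ t, V t ∈ tangent (γ t)) ∧
    ∀ t, ∃ D, HasDerivAt V D t ∧ ∀ X ∈ tangent (γ t), metric 1 D X = 0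

/-- `γ` is the geodesic of `Gr_{n,p}` with `γ 0 = P` and `γ' 0 = X`: a differentiable curve whose
velocity field is parallel along it. -/
def IsGeodesicFrom (P : Gr n p) (X : Matrix (Fin n) (Fin n) ℝ) (γ : ℝ → Gr n p) : Prop :=
  γ 0 = P ∧ ∃ V : ℝ → Matrix (Fin n) (Fin n) ℝ,
    (∀ t, HasDerivAt (fun s => (γ s).mat) (V t) t) ∧ IsParallelAlong γ V ∧ V 0 = X

open Classical in
/-- The exponential map: `Exp_P(X) = γ 1` for the geodesic `γ` with `γ 0 = P`, `γ' 0 = X`.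
(The value `P` is a placeholder for `X` not tangent at `P`.) -/
noncomputable def expMap (P : Gr n p) (X : Matrix (Fin n) (Fin n) ℝ) : Gr n p :=
  if h : ∃ γ : ℝ → Gr n p, IsGeodesicFrom P X γ then h.choose 1 else P

/-- `X` is the initial velocity of a shortest geodesic `t ↦ Exp_P(t X)`, `t ∈ [0,1]`, from `P`
to `Q`. (Comparison of lengths does not depend on `κ`; we take `κ = 1`.) -/
def IsShortest (P Q : Gr n p) (X : Matrix (Fin n) (Fin n) ℝ) : Prop :=
  X ∈ tangent P ∧ expMap P X = Q ∧
    ∀ Y ∈ tangent P, expMap P Y = Q → metric 1 X X ≤ metric 1 Y Y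

/-- `Log_P(Q)` is defined: there is exactly one shortest geodesic from `P` to `Q`. On a complete
Riemannian manifold this is so whenever `Q` is not in the cut locus of `P`; on `Gr_{n,p}` it is so
exactly then, since any two points one of whose principal angles is `π/2` are joined by at least
two shortest geodesics. -/
def LogDefined (P Q : Gr n p) : Prop :=
  ∃! X, IsShortest P Q X

open Classical in
/-- The logarithmic map: `Log_P(Q)` is the initial velocity of the unique shortest geodesic from
`P` to `Q` (and the placeholder `0` if it is not defined). -/
noncomputable def logMap (P Q : Gr n p) : Matrix (Fin n) (Fin n) ℝ :=
  if h : LogDefined P Q then h.choose else 0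

open Classical in
/-- Parallel transport of `X` from `P` to `Q` along the unique shortest geodesic from `P` to `Q`
(with placeholder `0` where there is none). -/
noncomputable def transport (P Q : Gr n p) (X : Matrix (Fin n) (Fin n) ℝ) :
    Matrix (Fin n) (Fin n) ℝ :=
  if h : LogDefined P Q ∧ ∃ (V : ℝ → Matrix (Fin n) (Fin n) ℝ) (γ : ℝ → Gr n p),
      IsGeodesicFrom P (logMap P Q) γ ∧ IsParallelAlong γ V ∧ V 0 = X
  then h.2.choose 1 else 0

/-- The binary operation `P ⊕ Q = Exp_P(T_{I → P}(Log_I(Q)))`, where `I = I_{n,p}`. -/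
noncomputable def gyroAdd (hp : p ≤ n) (P Q : Gr n p) : Gr n p :=
  expMap P (transport (base hp) P (logMap (base hp) Q))

/-- The scalar multiplication `t ⊗ P = Exp_I(t Log_I(P))`, where `I = I_{n,p}`. -/
noncomputable def gyroSMul (hp : p ≤ n) (t : ℝ) (P : Gr n p) : Gr n p :=
  expMap (base hp) (t • logMap (base hp) P)

/-- The inverse operation `⊖ P = (-1) ⊗ P = Exp_I(-Log_I(P))`. -/
noncomputable def gyroInv (hp : p ≤ n) (P : Gr n p) : Gr n p :=
  gyroSMul hp (-1) P

/-- The Grassmann inner product `⟨P, Q⟩ = ⟨Log_I(P), Log_I(Q)⟩_I`. -/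
noncomputable def gyroInner (hp : p ≤ n) (κ : ℝ) (P Q : Gr n p) : ℝ :=
  metric κ (logMap (base hp) P) (logMap (base hp) Q)

/-- The Grassmann norm `‖P‖ = √⟨P, P⟩`. -/
noncomputable def gyroNorm (hp : p ≤ n) (κ : ℝ) (P : Gr n p) : ℝ :=
  Real.sqrt (gyroInner hp κ P P)

/-- The Grassmann gyrodistance `d(P, Q) = ‖⊖ P ⊕ Q‖`. -/
noncomputable def gyroDist (hp : p ≤ n) (κ : ℝ) (P Q : Gr n p) : ℝ :=
  gyroNorm hp κ (gyroAdd hp (gyroInv hp P) Q)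

/-- `d(P, Q)` is defined: none of `P`, `Q`, `⊖ P ⊕ Q` is in the cut locus of `I_{n,p}`. -/
def GyroDistDefined (hp : p ≤ n) (P Q : Gr n p) : Prop :=
  LogDefined (base hp) P ∧ LogDefined (base hp) Q ∧
    LogDefined (base hp) (gyroAdd hp (gyroInv hp P) Q)

/-- Grassmann gyroisometry: `d(ω P, ω Q) = d(P, Q)` for all `P`, `Q` for which `d(P, Q)` is
defined; `d(ω P, ω Q)` has to be defined as well. -/
def IsGyroisometry (hp : p ≤ n) (κ : ℝ) (ω : Gr n p → Gr n p) : Prop :=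
  ∀ P Q : Gr n p, GyroDistDefined hp P Q →
    GyroDistDefined hp (ω P) (ω Q) ∧ gyroDist hp κ (ω P) (ω Q) = gyroDist hp κ P Q

end Gr

/-! Let S = 2I - 1. Conjugation by S is the geodesic symmetry s at I: it fixes I and acts as -1 on
the tangent space there, so it reverses geodesics through I and preserves which of them are
shortest. Hence ⊖ agrees with s wherever `Log_I` is defined (`gyroInv_eq_symmetry`).

Put Ω = [Log_I P, I]. The geodesic from I to P and the transport along it are both conjugation by
exp(tΩ), so P ⊕ Q = exp(Ω) Q exp(-Ω) (`mat_gyroAdd`). This equals I exactly when Q = exp(-Ω) I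
exp(Ω) = s(P), which gives (i). Conjugation by S commutes with exp, so s(P) ⊕ s(Q) = s(P ⊕ Q); as s
preserves the norm, (ii) follows.

Since `expMap` and `transport` are defined by choice, the closed forms need uniqueness of geodesics
(`IsGeodesicFrom.eq_geodesic`) and of parallel fields (`IsParallelAlong.eq_exp_conj`). -/

open NormedSpace
open scoped Matrix.Norms.Operator

/-! ### Block decomposition with respect to an idempotent -/

section OffDiagonal

variable {R : Type*} [Ring R]

/-- `A` exchanges the range and the kernel of the idempotent `P`. -/
def IsOffDiagonal (P A : R) : Prop :=
  P * A + A * P = A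

/-- Moving P past an off-diagonal factor turns it into 1 - P; two such factors restore it. -/
theorem IsOffDiagonal.mul_comm_mul {P A B : R} (hA : IsOffDiagonal P A) (hB : IsOffDiagonal P B) :
    P * (A * B) = A * B * P := by
  have h1 : P * A = A - A * P := eq_sub_of_add_eq hA
  have h2 : P * B = B - B * P := eq_sub_of_add_eq hB
  rw [← mul_assoc, h1, sub_mul, mul_assoc A P B, h2, mul_sub, mul_assoc A B P]
  abel

theorem IsOffDiagonal.mul_mul_self {P A : R} (hP : P * P = P) (hA : IsOffDiagonal P A) :
    P * A * P = 0 := by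
  have h1 : P * (P * A + A * P) = P * A := congrArg (P * ·) hA
  rw [mul_add, ← mul_assoc, hP, ← mul_assoc] at h1
  simpa using h1

theorem IsOffDiagonal.eq_zero_of_commute {P A : R} (hP : P * P = P) (hA : IsOffDiagonal P A)
    (hc : P * A = A * P) : A = 0 := by
  have h0 := hA.mul_mul_self hP
  rw [hc, mul_assoc, hP] at h0
  have h1 : P * A + A * P = A := hA
  rw [hc, h0, add_zero] at h1
  exact h1.symm

theorem IsOffDiagonal.commutator {P A : R} (hP : P * P = P) (hA : IsOffDiagonal P A) :
    IsOffDiagonal P (A * P - P * A) := by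
  have h0 := hA.mul_mul_self hP
  unfold IsOffDiagonal
  rw [mul_sub, sub_mul, ← mul_assoc, h0, mul_assoc A, ← mul_assoc P P, hP]
  abel

/-- On off-diagonal elements the commutator with P is an involution, so a velocity can be recovered
from its generator. -/
theorem IsOffDiagonal.commutator_commutator {P A : R} (hP : P * P = P) (hA : IsOffDiagonal P A) :
    (A * P - P * A) * P - P * (A * P - P * A) = A := by
  have h0 := hA.mul_mul_self hP
  have h1 : P * A + A * P = A := hA
  rw [mul_sub, sub_mul, ← mul_assoc, h0, mul_assoc A, ← mul_assoc P P, hP,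
    sub_zero, zero_sub, sub_neg_eq_add, add_comm, h1]

theorem IsOffDiagonal.of_conj {P W E F : R} (hFE : F * E = 1)
    (h : IsOffDiagonal (E * P * F) W) : IsOffDiagonal P (F * W * E) := by
  have h1 : F * (E * P * F * W + W * (E * P * F)) * E = F * W * E := congrArg (F * · * E) h
  rw [show F * (E * P * F * W + W * (E * P * F)) * E
    = (F * E) * P * (F * W * E) + F * W * E * P * (F * E) by noncomm_ring, hFE, one_mul,
    mul_one] at h1
  exact h1

theorem commute_of_conj {P D E F : R} (hFE : F * E = 1)
    (h : E * P * F * D = D * (E * P * F)) : P * (F * D * E) = F * D * E * P := by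
  have h1 : F * (E * P * F * D) * E = F * (D * (E * P * F)) * E := congrArg (F * · * E) h
  rwa [show F * (E * P * F * D) * E = (F * E) * P * (F * D * E) by noncomm_ring,
    show F * (D * (E * P * F)) * E = F * D * E * P * (F * E) by noncomm_ring, hFE, one_mul,
    mul_one] at h1

end OffDiagonal

/-! ### Orthogonal action, tangent and normal spaces -/

namespace Gr

variable {n p : ℕ}

theorem mat_injective : Function.Injective (mat : Gr n p → Matrix (Fin n) (Fin n) ℝ) :=
  Subtype.val_injective

theorem transpose_mat (P : Gr n p) : P.matᵀ = P.mat := P.2.1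

theorem mat_mul_self (P : Gr n p) : P.mat * P.mat = P.mat := P.2.2.1

theorem mem_tangent {P : Gr n p} {X : Matrix (Fin n) (Fin n) ℝ} :
    X ∈ tangent P ↔ Xᵀ = X ∧ IsOffDiagonal P.mat X := Iff.rfl

/-- The action of an orthogonal matrix `U` (with inverse `Uᵀ`) on the Grassmannian. -/
def conj (U : Matrix (Fin n) (Fin n) ℝ) (hU : Uᵀ * U = 1) (P : Gr n p) : Gr n p :=
  ⟨U * P.mat * Uᵀ, by
    refine ⟨?_, ?_, ?_⟩
    · rw [Matrix.transpose_mul, Matrix.transpose_mul, Matrix.transpose_transpose,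
        transpose_mat, mul_assoc]
    · rw [show U * P.mat * Uᵀ * (U * P.mat * Uᵀ) = U * P.mat * (Uᵀ * U) * P.mat * Uᵀ by
        noncomm_ring, hU, mul_one, mul_assoc U, mat_mul_self]
    · have hd : U.det * U.det = 1 := by
        simpa [Matrix.det_mul, Matrix.det_transpose] using congrArg Matrix.det hU
      have hu : IsUnit U.det := IsUnit.of_mul_eq_one _ hd
      rw [Matrix.rank_mul_eq_left_of_isUnit_det _ _ (by rwa [Matrix.det_transpose]),
        Matrix.rank_mul_eq_right_of_isUnit_det _ _ hu]
      exact P.2.2.2⟩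

@[simp]
theorem mat_conj (U : Matrix (Fin n) (Fin n) ℝ) (hU : Uᵀ * U = 1) (P : Gr n p) :
    (conj U hU P).mat = U * P.mat * Uᵀ := rfl

theorem conj_mem_tangent {U : Matrix (Fin n) (Fin n) ℝ} (hU : Uᵀ * U = 1) {P : Gr n p}
    {X : Matrix (Fin n) (Fin n) ℝ} (hX : X ∈ tangent P) :
    U * X * Uᵀ ∈ tangent (conj U hU P) := by
  have h : P.mat * X + X * P.mat = X := hX.2
  refine ⟨?_, ?_⟩
  · rw [Matrix.transpose_mul, Matrix.transpose_mul, Matrix.transpose_transpose, hX.1, mul_assoc]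
  · rw [mat_conj, show U * P.mat * Uᵀ * (U * X * Uᵀ) + U * X * Uᵀ * (U * P.mat * Uᵀ)
      = U * (P.mat * (Uᵀ * U) * X + X * (Uᵀ * U) * P.mat) * Uᵀ by noncomm_ring, hU, mul_one,
      mul_one, h]

/-- The skew-symmetric generator `[X, P]` of the geodesic from `P` with velocity `X`. -/
def generator (P : Gr n p) (X : Matrix (Fin n) (Fin n) ℝ) : Matrix (Fin n) (Fin n) ℝ :=
  X * P.mat - P.mat * X

theorem transpose_generator {P : Gr n p} {X : Matrix (Fin n) (Fin n) ℝ} (hX : Xᵀ = X) :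
    (generator P X)ᵀ = -generator P X := by
  simp [generator, Matrix.transpose_sub, Matrix.transpose_mul, transpose_mat, hX]

theorem generator_conj {U : Matrix (Fin n) (Fin n) ℝ} (hU : Uᵀ * U = 1) (P : Gr n p)
    (X : Matrix (Fin n) (Fin n) ℝ) :
    generator (conj U hU P) (U * X * Uᵀ) = U * generator P X * Uᵀ := by
  unfold generator
  rw [mat_conj, show U * X * Uᵀ * (U * P.mat * Uᵀ) - U * P.mat * Uᵀ * (U * X * Uᵀ)
      = U * (X * (Uᵀ * U) * P.mat - P.mat * (Uᵀ * U) * X) * Uᵀ by noncomm_ring, hU, mul_one,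
      mul_one]

theorem generator_neg (P : Gr n p) (X : Matrix (Fin n) (Fin n) ℝ) :
    generator P (-X) = -generator P X := by
  simp only [generator]; noncomm_ring

/-- A matrix that is symmetric and normal to the tangent space at `P` commutes with `P`. -/
theorem commute_of_normal {P : Gr n p} {D : Matrix (Fin n) (Fin n) ℝ} (hD : Dᵀ = D)
    (h : ∀ X ∈ tangent P, metric 1 D X = 0) : P.mat * D = D * P.mat := by
  have hP := P.mat_mul_self
  set A := P.mat with hA
  -- The off-diagonal part AD(1 - A) + (1 - A)DA of D, that is, its tangential projection; the goal
  -- is X = 0, via tr(X²) = tr(DX) = 0.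
  set X := A * D + D * A - 2 • (A * D * A) with hXdef
  have hAX : A * X = A * D - A * D * A := by
    rw [hXdef, mul_sub, mul_add, mul_smul_comm, ← mul_assoc, ← mul_assoc, ← mul_assoc,
      ← mul_assoc, hP, two_smul]
    abel
  have hXA : X * A = D * A - A * D * A := by
    rw [hXdef, sub_mul, add_mul, smul_mul_assoc, mul_assoc D, mul_assoc (A * D) A A, hP, two_smul]
    abel
  have hXt : Xᵀ = X := by
    rw [hXdef]
    simp only [Matrix.transpose_sub, Matrix.transpose_add, Matrix.transpose_smul,
      Matrix.transpose_mul, hD, hA, transpose_mat, mul_assoc]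
    abel
  have hXo : A * X + X * A = X := by
    rw [hAX, hXA, hXdef, two_smul]; abel
  have h1 : (D * X).trace = 0 := by
    have := h X ⟨hXt, hXo⟩
    simpa [metric, hD] using this
  have h2 : (X * X).trace = 0 := by
    have hAXA : A * X * A = 0 := IsOffDiagonal.mul_mul_self hP hXo
    have e : X * X = A * D * X + D * A * X - 2 • (A * D * A * X) := by
      rw [hXdef]; noncomm_ring
    have t1 : (A * D * A * X).trace = 0 := by
      rw [show A * D * A * X = (A * D) * (A * X) by noncomm_ring, Matrix.trace_mul_comm,
        ← mul_assoc, hAXA, zero_mul, Matrix.trace_zero]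
    have t2 : (A * D * X).trace = (D * X * A).trace := by
      rw [mul_assoc, Matrix.trace_mul_comm]
    rw [e, Matrix.trace_sub, Matrix.trace_smul, t1, smul_zero, sub_zero, Matrix.trace_add, t2,
      ← Matrix.trace_add, mul_assoc, mul_assoc, ← mul_add, add_comm (X * A), hXo, h1]
  have h3 : X = 0 := by
    rw [← Matrix.trace_conjTranspose_mul_self_eq_zero_iff,
      Matrix.conjTranspose_eq_transpose_of_trivial,
      hXt, h2]
  rw [h3, mul_zero] at hAX
  rw [h3, zero_mul] at hXA
  rw [sub_eq_zero.1 hAX.symm, sub_eq_zero.1 hXA.symm]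

/-- A matrix commuting with `P` is normal to the tangent space at `P`. -/
theorem normal_of_commute {P : Gr n p} {D X : Matrix (Fin n) (Fin n) ℝ}
    (h : P.mat * D = D * P.mat) (hX : X ∈ tangent P) : metric 1 D X = 0 := by
  have hP := P.mat_mul_self
  have h0 : P.mat * X * P.mat = 0 := IsOffDiagonal.mul_mul_self hP hX.2
  have hXo : P.mat * X + X * P.mat = X := hX.2
  have ht : P.mat * Dᵀ = Dᵀ * P.mat := by
    have := congrArg Matrix.transpose h
    rw [Matrix.transpose_mul, Matrix.transpose_mul, transpose_mat] at this
    exact this.symm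
  have t : (Dᵀ * (P.mat * X)).trace = 0 := by
    rw [← hP, mul_assoc, ← mul_assoc, ← ht, mul_assoc, Matrix.trace_mul_comm, mul_assoc, h0,
      mul_zero, Matrix.trace_zero]
  have t' : (Dᵀ * (X * P.mat)).trace = 0 := by
    rw [← mul_assoc, Matrix.trace_mul_comm, ← mul_assoc, ht, mul_assoc, t]
  rw [metric, one_mul, ← hXo, mul_add, Matrix.trace_add, t, t', add_zero]

/-! ### Geodesics and parallel fields in closed form -/

theorem hasDerivAt_transpose_eq {V : ℝ → Matrix (Fin n) (Fin n) ℝ} {D : Matrix (Fin n) (Fin n) ℝ}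
    {t : ℝ} (hV : ∀ s, (V s)ᵀ = V s) (h : HasDerivAt V D t) : Dᵀ = D := by
  have h1 : HasDerivAt (fun s => (V s)ᵀ) Dᵀ t :=
    (LinearMap.toContinuousLinearMap
      (Matrix.transposeLinearEquiv (Fin n) (Fin n) ℝ ℝ).toLinearMap).hasFDerivAt.comp_hasDerivAt t h
  simp only [hV] at h1
  exact h1.unique h

/-- The derivative of the one-parameter conjugation of a differentiable curve. -/
theorem hasDerivAt_exp_conj (Ω : Matrix (Fin n) (Fin n) ℝ) {W : ℝ → Matrix (Fin n) (Fin n) ℝ}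
    {D : Matrix (Fin n) (Fin n) ℝ} {t : ℝ} (h : HasDerivAt W D t) :
    HasDerivAt (fun s : ℝ => exp (s • Ω) * W s * exp (-(s • Ω)))
      (exp (t • Ω) * (Ω * W t - W t * Ω + D) * exp (-(t • Ω))) t := by
  have h1 : HasDerivAt (fun s : ℝ => exp (s • Ω)) (exp (t • Ω) * Ω) t :=
    hasDerivAt_exp_smul_const Ω t
  have h2 : HasDerivAt (fun s : ℝ => exp (-(s • Ω))) (-Ω * exp (-(t • Ω))) t := by
    have h := hasDerivAt_exp_smul_const' (𝕂 := ℝ) (-Ω) t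
    simp only [smul_neg] at h
    exact h
  have h3 := (h1.mul h).mul h2
  refine h3.congr_deriv ?_
  rw [Pi.mul_apply]
  noncomm_ring

theorem exp_neg_mul_exp (A : Matrix (Fin n) (Fin n) ℝ) : exp (-A) * exp A = 1 := by
  rw [← Matrix.exp_add_of_commute _ _ (Commute.neg_left (Commute.refl A)), neg_add_cancel, exp_zero]

theorem exp_mul_exp_neg (A : Matrix (Fin n) (Fin n) ℝ) : exp A * exp (-A) = 1 := by
  simpa using exp_neg_mul_exp (-A)

theorem transpose_exp_of_skew {A : Matrix (Fin n) (Fin n) ℝ} (hA : Aᵀ = -A) :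
    (exp A)ᵀ = exp (-A) := by
  rw [← Matrix.exp_transpose, hA]

theorem transpose_exp_mul_exp_of_skew {A : Matrix (Fin n) (Fin n) ℝ} (hA : Aᵀ = -A) :
    (exp A)ᵀ * exp A = 1 := by
  rw [transpose_exp_of_skew hA, exp_neg_mul_exp]

theorem transpose_smul_of_skew {A : Matrix (Fin n) (Fin n) ℝ} (hA : Aᵀ = -A) (t : ℝ) :
    (t • A)ᵀ = -(t • A) := by
  rw [Matrix.transpose_smul, hA, smul_neg]

/-- The geodesic through `P` with the skew-symmetric generator `Ω`. -/
noncomputable def geodesic (P : Gr n p) {Ω : Matrix (Fin n) (Fin n) ℝ} (hΩ : Ωᵀ = -Ω) (t : ℝ) :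
    Gr n p :=
  conj (exp (t • Ω)) (transpose_exp_mul_exp_of_skew (transpose_smul_of_skew hΩ t)) P

theorem mat_geodesic (P : Gr n p) {Ω : Matrix (Fin n) (Fin n) ℝ} (hΩ : Ωᵀ = -Ω) (t : ℝ) :
    (geodesic P hΩ t).mat = exp (t • Ω) * P.mat * exp (-(t • Ω)) := by
  rw [geodesic, mat_conj, transpose_exp_of_skew (transpose_smul_of_skew hΩ t)]

theorem exp_conj_mem_tangent {P : Gr n p} {Ω : Matrix (Fin n) (Fin n) ℝ} (hΩ : Ωᵀ = -Ω) (t : ℝ)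
    {X : Matrix (Fin n) (Fin n) ℝ} (hX : X ∈ tangent P) :
    exp (t • Ω) * X * exp (-(t • Ω)) ∈ tangent (geodesic P hΩ t) := by
  rw [← transpose_exp_of_skew (transpose_smul_of_skew hΩ t)]
  exact conj_mem_tangent _ hX

/-- The derivative is the conjugate of [Ω, Y]. Both factors are off-diagonal, so their commutator is
block-diagonal, hence normal. -/
theorem isParallelAlong_exp_conj {P : Gr n p} {Ω : Matrix (Fin n) (Fin n) ℝ} (hΩ : Ωᵀ = -Ω)
    (hΩP : IsOffDiagonal P.mat Ω) {Y : Matrix (Fin n) (Fin n) ℝ} (hY : Y ∈ tangent P) :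
    IsParallelAlong (geodesic P hΩ) fun t => exp (t • Ω) * Y * exp (-(t • Ω)) := by
  refine ⟨fun t => exp_conj_mem_tangent hΩ t hY, fun t => ⟨_, hasDerivAt_exp_conj Ω
    (hasDerivAt_const t Y), fun X hX => normal_of_commute ?_ hX⟩⟩
  rw [mat_geodesic]
  have hc : P.mat * (Ω * Y - Y * Ω) = (Ω * Y - Y * Ω) * P.mat := by
    rw [mul_sub, sub_mul, hΩP.mul_comm_mul hY.2, IsOffDiagonal.mul_comm_mul hY.2 hΩP]
  set E := exp (t • Ω)
  set F := exp (-(t • Ω))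
  have hFE : F * E = 1 := exp_neg_mul_exp _
  set Z := Ω * Y - Y * Ω
  rw [add_zero, show E * P.mat * F * (E * Z * F) = E * P.mat * (F * E) * Z * F by noncomm_ring,
    show E * Z * F * (E * P.mat * F) = E * Z * (F * E) * P.mat * F by noncomm_ring, hFE, mul_one,
    mul_one, mul_assoc E, hc, ← mul_assoc E]

theorem isGeodesicFrom_geodesic {P : Gr n p} {X : Matrix (Fin n) (Fin n) ℝ} (hX : X ∈ tangent P) :
    IsGeodesicFrom P X (geodesic P (Ω := generator P X) (transpose_generator hX.1)) := by
  have hP := P.mat_mul_self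
  refine ⟨mat_injective ?_, fun t => exp (t • generator P X) * X * exp (-(t • generator P X)),
    fun t => ?_, isParallelAlong_exp_conj _ (IsOffDiagonal.commutator hP hX.2) hX, ?_⟩
  · simp [mat_geodesic]
  · simp only [mat_geodesic]
    refine (hasDerivAt_exp_conj _ (hasDerivAt_const t P.mat)).congr_deriv ?_
    rw [add_zero, generator, IsOffDiagonal.commutator_commutator hP hX.2]
  · simp

theorem eq_of_hasDerivAt_zero {W : ℝ → Matrix (Fin n) (Fin n) ℝ} (h : ∀ t, HasDerivAt W 0 t)
    (s t : ℝ) : W s = W t :=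
  is_const_of_deriv_eq_zero (fun t => (h t).differentiableAt) (fun t => (h t).deriv) s t

/-- Uniqueness for the linear equation W' = [Ω, W]: the curve pulled back by exp(-tΩ) is constant.
-/
theorem eq_exp_conj_of_conj_const {W : ℝ → Matrix (Fin n) (Fin n) ℝ}
    {Ω : Matrix (Fin n) (Fin n) ℝ}
    (h : ∀ t : ℝ, HasDerivAt (fun s : ℝ => exp (s • -Ω) * W s * exp (-(s • -Ω))) 0 t) (t : ℝ) :
    W t = exp (t • Ω) * W 0 * exp (-(t • Ω)) := by
  have h1 := eq_of_hasDerivAt_zero h t 0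
  simp only [smul_neg, neg_neg, zero_smul, neg_zero, exp_zero, one_mul, mul_one] at h1
  rw [← h1, show exp (t • Ω) * (exp (-(t • Ω)) * W t * exp (t • Ω)) * exp (-(t • Ω))
    = (exp (t • Ω) * exp (-(t • Ω))) * W t * (exp (t • Ω) * exp (-(t • Ω))) by noncomm_ring,
    exp_mul_exp_neg, one_mul, mul_one]

/-- The momentum [γ', γ] is conserved: its derivative is [γ'', γ] + [γ', γ'], and γ'' is normal, so
it commutes with γ. The double commutator then turns conservation into the linear equation γ' = [Ω,
γ]. -/
theorem IsGeodesicFrom.eq_geodesic {P : Gr n p} {X : Matrix (Fin n) (Fin n) ℝ} {γ : ℝ → Gr n p}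
    (hX : X ∈ tangent P) (h : IsGeodesicFrom P X γ) :
    γ = geodesic P (Ω := generator P X) (transpose_generator hX.1) := by
  obtain ⟨h0, V, hV, ⟨hVt, hVn⟩, hV0⟩ := h
  have hgen : ∀ t, HasDerivAt (fun s => generator (γ s) (V s)) 0 t := by
    intro t
    obtain ⟨D, hD, hn⟩ := hVn t
    have hc := commute_of_normal (hasDerivAt_transpose_eq (fun s => (hVt s).1) hD) hn
    refine ((hD.mul (hV t)).sub ((hV t).mul hD)).congr_deriv ?_
    rw [hc]; abel
  have hconst : ∀ t, generator (γ t) (V t) = generator P X := by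
    intro t
    rw [eq_of_hasDerivAt_zero hgen t 0, h0, hV0]
  funext t
  apply mat_injective
  rw [mat_geodesic]
  nth_rewrite 2 [← h0]
  refine eq_exp_conj_of_conj_const (W := fun s => (γ s).mat) (fun t => ?_) t
  refine (hasDerivAt_exp_conj _ (hV t)).congr_deriv ?_
  have := IsOffDiagonal.commutator_commutator (γ t).mat_mul_self (hVt t).2
  rw [show (V t * (γ t).mat - (γ t).mat * V t) = _ from hconst t] at this
  rw [show -generator P X * (γ t).mat - (γ t).mat * -generator P X + V t
    = V t - (generator P X * (γ t).mat - (γ t).mat * generator P X) by noncomm_ring, this]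
  simp

/-- Pulled back by exp(-tΩ), the field stays in the fixed tangent space at P, so its derivative is
off-diagonal. Parallelism makes that derivative block-diagonal as well, hence zero. -/
theorem IsParallelAlong.eq_exp_conj {P : Gr n p} {Ω : Matrix (Fin n) (Fin n) ℝ} {hΩ : Ωᵀ = -Ω}
    (hΩP : IsOffDiagonal P.mat Ω) {W : ℝ → Matrix (Fin n) (Fin n) ℝ}
    (h : IsParallelAlong (geodesic P hΩ) W) (t : ℝ) :
    W t = exp (t • Ω) * W 0 * exp (-(t • Ω)) := by
  obtain ⟨hWt, hWn⟩ := h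
  have hP := P.mat_mul_self
  refine eq_exp_conj_of_conj_const (fun t => ?_) t
  obtain ⟨D, hD, hn⟩ := hWn t
  have hc := commute_of_normal (hasDerivAt_transpose_eq (fun s => (hWt s).1) hD) hn
  have hder := hasDerivAt_exp_conj (-Ω) hD
  have hoff : ∀ s : ℝ, IsOffDiagonal P.mat (exp (s • -Ω) * W s * exp (-(s • -Ω))) := by
    intro s
    have h1 : IsOffDiagonal _ (W s) := (hWt s).2
    rw [mat_geodesic] at h1
    simpa only [smul_neg, neg_neg] using h1.of_conj (exp_neg_mul_exp _)
  refine hder.congr_deriv (IsOffDiagonal.eq_zero_of_commute hP ?_ ?_)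
  -- Differentiate the identity P w + w P = w satisfied by the pulled-back field w.
  · have h2 := ((hasDerivAt_const t P.mat).mul hder).add (hder.mul (hasDerivAt_const t P.mat))
    have h3 := (h2.congr_of_eventuallyEq
      (Filter.Eventually.of_forall fun s => (hoff s).symm)).unique hder
    rw [zero_mul, mul_zero, zero_add, add_zero] at h3
    exact h3
  -- The derivative is -[Ω, w] plus the pullback of the normal vector D; both terms commute with P.
  · rw [mat_geodesic] at hc
    have hDc := commute_of_conj (exp_neg_mul_exp _) hc
    have hw := hoff t
    simp only [smul_neg, neg_neg] at hw ⊢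
    have hcomm : Commute (exp (-(t • Ω))) Ω :=
      ((Commute.refl Ω).smul_left t).neg_left.exp_left
    have hcomm' : Commute (exp (t • Ω)) Ω := ((Commute.refl Ω).smul_left t).exp_left
    set E := exp (t • Ω)
    set F := exp (-(t • Ω))
    rw [show F * (-Ω * W t - W t * -Ω + D) * E
      = -(F * Ω * W t * E) + F * W t * (Ω * E) + F * D * E by noncomm_ring, hcomm.eq,
      ← hcomm'.eq, show Ω * F * W t * E = Ω * (F * W t * E) by noncomm_ring,
      ← mul_assoc (F * W t), mul_add, add_mul, hDc, mul_add, add_mul, mul_neg, neg_mul,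
      hΩP.mul_comm_mul hw, hw.mul_comm_mul hΩP]

/-! ### Exponential, transport and addition as conjugations -/

theorem expMap_eq {P : Gr n p} {X : Matrix (Fin n) (Fin n) ℝ} (hX : X ∈ tangent P) :
    expMap P X = geodesic P (Ω := generator P X) (transpose_generator hX.1) 1 := by
  have h : ∃ γ : ℝ → Gr n p, IsGeodesicFrom P X γ := ⟨_, isGeodesicFrom_geodesic hX⟩
  rw [expMap, dif_pos h]
  exact congrFun (h.choose_spec.eq_geodesic hX) 1

theorem mat_expMap {P : Gr n p} {X : Matrix (Fin n) (Fin n) ℝ} (hX : X ∈ tangent P) :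
    (expMap P X).mat = exp (generator P X) * P.mat * exp (-generator P X) := by
  rw [expMap_eq hX, mat_geodesic, one_smul]

theorem LogDefined.isShortest_logMap {P Q : Gr n p} (h : LogDefined P Q) :
    IsShortest P Q (logMap P Q) := by
  rw [logMap, dif_pos h]
  exact h.choose_spec.1

theorem LogDefined.eq_logMap {P Q : Gr n p} (h : LogDefined P Q) {X : Matrix (Fin n) (Fin n) ℝ}
    (hX : IsShortest P Q X) : X = logMap P Q :=
  h.unique hX h.isShortest_logMap

theorem transport_eq {P Q : Gr n p} (h : LogDefined P Q) {Y : Matrix (Fin n) (Fin n) ℝ}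
    (hY : Y ∈ tangent P) :
    transport P Q Y =
      exp (generator P (logMap P Q)) * Y * exp (-generator P (logMap P Q)) := by
  have hX := h.isShortest_logMap.1
  have hgen := IsOffDiagonal.commutator P.mat_mul_self hX.2
  have hex : LogDefined P Q ∧ ∃ (V : ℝ → Matrix (Fin n) (Fin n) ℝ) (γ : ℝ → Gr n p),
      IsGeodesicFrom P (logMap P Q) γ ∧ IsParallelAlong γ V ∧ V 0 = Y :=
    ⟨h, _, _, isGeodesicFrom_geodesic hX,
      isParallelAlong_exp_conj (transpose_generator hX.1) hgen hY, by simp⟩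
  rw [transport, dif_pos hex]
  obtain ⟨γ, hγ, hV, hV0⟩ := hex.2.choose_spec
  rw [hγ.eq_geodesic hX] at hV
  rw [hV.eq_exp_conj hgen 1, hV0, one_smul]
  rfl

theorem conj_expMap {U : Matrix (Fin n) (Fin n) ℝ} (hU : Uᵀ * U = 1) {P : Gr n p}
    {X : Matrix (Fin n) (Fin n) ℝ} (hX : X ∈ tangent P) :
    conj U hU (expMap P X) = expMap (conj U hU P) (U * X * Uᵀ) := by
  apply mat_injective
  have hinv : U⁻¹ = Uᵀ := Matrix.inv_eq_left_inv hU
  have hu : IsUnit U := IsUnit.of_mul_eq_one_right _ hU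
  have he : ∀ A, exp (U * A * Uᵀ) = U * exp A * Uᵀ := by
    intro A
    rw [← hinv, Matrix.exp_conj _ _ hu]
  rw [mat_conj, mat_expMap hX, mat_expMap (conj_mem_tangent hU hX), generator_conj,
    ← neg_mul, ← mul_neg, he, he, mat_conj]
  set E := exp (generator P X)
  set F := exp (-generator P X)
  rw [show U * E * Uᵀ * (U * P.mat * Uᵀ) * (U * F * Uᵀ)
    = U * E * (Uᵀ * U) * P.mat * (Uᵀ * U) * F * Uᵀ by noncomm_ring, hU]
  noncomm_ring

/-- The transport of a vector along the geodesic from the base point `I` to `P`, followed by the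
exponential map at `P`. -/
theorem mat_gyroAdd (hp : p ≤ n) {P Q : Gr n p} (hP : LogDefined (base hp) P)
    (hQ : LogDefined (base hp) Q) :
    (gyroAdd hp P Q).mat = exp (generator (base hp) (logMap (base hp) P)) * Q.mat *
      exp (-generator (base hp) (logMap (base hp) P)) := by
  have hX := hP.isShortest_logMap
  have hY := hQ.isShortest_logMap
  set Ω := generator (base hp) (logMap (base hp) P) with hΩdef
  have hΩ : Ωᵀ = -Ω := transpose_generator hX.1.1
  -- P is the image of I under exp Ω, and transport is conjugation by exp Ω, so equivariance of the
  -- exponential map carries Exp_I(Log_I Q) = Q to P ⊕ Q.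
  have hPc : conj (exp Ω) (transpose_exp_mul_exp_of_skew hΩ) (base hp) = P := by
    apply mat_injective
    rw [mat_conj, transpose_exp_of_skew hΩ, ← mat_expMap hX.1, hX.2.1]
  rw [gyroAdd, transport_eq hP hY.1, ← hΩdef, ← transpose_exp_of_skew hΩ]
  nth_rewrite 1 [← hPc]
  rw [← conj_expMap _ hY.1, hY.2.1, mat_conj]

/-! ### The geodesic symmetry at the base point -/

/-- The geodesic symmetry at the base point. -/
noncomputable def reflection (hp : p ≤ n) : Matrix (Fin n) (Fin n) ℝ :=
  2 • (base hp).mat - 1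

theorem transpose_reflection (hp : p ≤ n) : (reflection hp)ᵀ = reflection hp := by
  rw [reflection, Matrix.transpose_sub, Matrix.transpose_smul, transpose_mat, Matrix.transpose_one]

theorem reflection_mul_self (hp : p ≤ n) : reflection hp * reflection hp = 1 := by
  have h := (base hp).mat_mul_self
  rw [reflection, show (2 • (base hp).mat - 1) * (2 • (base hp).mat - 1)
    = 4 • ((base hp).mat * (base hp).mat) - 4 • (base hp).mat + 1 by noncomm_ring, h]
  simp

theorem transpose_reflection_mul_self (hp : p ≤ n) : (reflection hp)ᵀ * reflection hp = 1 := by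
  rw [transpose_reflection, reflection_mul_self]

/-- The symmetry of the Grassmannian at the base point. -/
noncomputable def symmetry (hp : p ≤ n) : Gr n p → Gr n p :=
  conj (reflection hp) (transpose_reflection_mul_self hp)

theorem mat_symmetry (hp : p ≤ n) (P : Gr n p) :
    (symmetry hp P).mat = reflection hp * P.mat * reflection hp := by
  rw [symmetry, mat_conj, transpose_reflection]

theorem symmetry_symmetry (hp : p ≤ n) (P : Gr n p) : symmetry hp (symmetry hp P) = P := by
  apply mat_injective
  rw [mat_symmetry, mat_symmetry, show reflection hp * (reflection hp * P.mat * reflection hp) *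
    reflection hp = (reflection hp * reflection hp) * P.mat * (reflection hp * reflection hp) by
    noncomm_ring, reflection_mul_self, one_mul, mul_one]

theorem symmetry_base (hp : p ≤ n) : symmetry hp (base hp) = base hp := by
  apply mat_injective
  have hc : reflection hp * (base hp).mat = (base hp).mat * reflection hp := by
    rw [reflection, sub_mul, mul_sub, smul_mul_assoc, mul_smul_comm, one_mul, mul_one]
  rw [mat_symmetry, hc, mul_assoc, reflection_mul_self, mul_one]

theorem reflection_conj_of_mem_tangent (hp : p ≤ n) {X : Matrix (Fin n) (Fin n) ℝ}
    (hX : X ∈ tangent (base hp)) : reflection hp * X * (reflection hp)ᵀ = -X := by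
  have h : (base hp).mat * X + X * (base hp).mat = X := hX.2
  have h1 : reflection hp * X = -X * reflection hp := by
    rw [reflection, ← sub_eq_zero, show (2 • (base hp).mat - 1) * X - -X * (2 • (base hp).mat - 1)
      = 2 • ((base hp).mat * X + X * (base hp).mat) - 2 • X by noncomm_ring, h, sub_self]
  rw [transpose_reflection, h1, mul_assoc, reflection_mul_self, mul_one]

theorem symmetry_expMap (hp : p ≤ n) {X : Matrix (Fin n) (Fin n) ℝ}
    (hX : X ∈ tangent (base hp)) :
    symmetry hp (expMap (base hp) X) = expMap (base hp) (-X) := by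
  rw [symmetry, conj_expMap _ hX, reflection_conj_of_mem_tangent hp hX]
  exact congrArg (fun P => expMap P (-X)) (symmetry_base hp)

theorem metric_neg_neg (κ : ℝ) (X Y : Matrix (Fin n) (Fin n) ℝ) :
    metric κ (-X) (-Y) = metric κ X Y := by
  simp [metric]

/-- Since the symmetry is an involution, negation matches the competing velocities toward s(Q) with
those toward Q, without changing length. -/
theorem IsShortest.symmetry {hp : p ≤ n} {Q : Gr n p} {X : Matrix (Fin n) (Fin n) ℝ}
    (h : IsShortest (base hp) Q X) : IsShortest (base hp) (symmetry hp Q) (-X) := by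
  refine ⟨neg_mem h.1, ?_, fun Y hY hYQ => ?_⟩
  · rw [← symmetry_expMap hp h.1, h.2.1]
  · rw [metric_neg_neg, ← metric_neg_neg 1 Y Y]
    refine h.2.2 _ (neg_mem hY) ?_
    rw [← symmetry_expMap hp hY, hYQ, symmetry_symmetry]

theorem LogDefined.symmetry {hp : p ≤ n} {Q : Gr n p} (h : LogDefined (base hp) Q) :
    LogDefined (base hp) (symmetry hp Q) := by
  refine ⟨_, h.isShortest_logMap.symmetry, fun Y hY => ?_⟩
  have h1 := hY.symmetry
  rw [symmetry_symmetry] at h1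
  rw [← h.eq_logMap h1, neg_neg]

theorem logMap_symmetry {hp : p ≤ n} {Q : Gr n p} (h : LogDefined (base hp) Q) :
    logMap (base hp) (symmetry hp Q) = -logMap (base hp) Q :=
  (h.symmetry.eq_logMap h.isShortest_logMap.symmetry).symm

theorem gyroInv_eq_symmetry {hp : p ≤ n} {P : Gr n p} (h : LogDefined (base hp) P) :
    gyroInv hp P = symmetry hp P := by
  rw [gyroInv, gyroSMul, neg_one_smul, ← symmetry_expMap hp h.isShortest_logMap.1,
    h.isShortest_logMap.2.1]

/-! ### Compatibility of the symmetry with the gyro-operations -/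

theorem gyroAdd_symmetry_symmetry {hp : p ≤ n} {P Q : Gr n p} (hP : LogDefined (base hp) P)
    (hQ : LogDefined (base hp) Q) :
    gyroAdd hp (symmetry hp P) (symmetry hp Q) = symmetry hp (gyroAdd hp P Q) := by
  apply mat_injective
  have hX := hP.isShortest_logMap.1
  have hinv : (reflection hp)⁻¹ = reflection hp := Matrix.inv_eq_left_inv (reflection_mul_self hp)
  have hu : IsUnit (reflection hp) := IsUnit.of_mul_eq_one_right _ (reflection_mul_self hp)
  -- Writing this generator as a conjugate by S, not as -G, lets the inner reflections cancel in
  -- pairs.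
  have hg : generator (base hp) (-logMap (base hp) P)
      = reflection hp * generator (base hp) (logMap (base hp) P) * reflection hp := by
    rw [← reflection_conj_of_mem_tangent hp hX]
    nth_rewrite 1 [← symmetry_base hp]
    rw [symmetry, generator_conj, transpose_reflection]
  rw [mat_gyroAdd hp hP.symmetry hQ.symmetry, logMap_symmetry hP, hg, mat_symmetry, mat_symmetry,
    mat_gyroAdd hp hP hQ]
  set G := generator (base hp) (logMap (base hp) P)
  set S := reflection hp
  have he : ∀ A, exp (S * A * S) = S * exp A * S := by
    intro A
    have := Matrix.exp_conj S A hu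
    rwa [hinv] at this
  have hSS : S * S = 1 := reflection_mul_self hp
  rw [← neg_mul, ← mul_neg, he, he,
    show S * exp G * S * (S * Q.mat * S) * (S * exp (-G) * S)
      = S * exp G * (S * S) * Q.mat * (S * S) * exp (-G) * S by noncomm_ring, hSS]
  noncomm_ring

theorem gyroNorm_symmetry {hp : p ≤ n} (κ : ℝ) {P : Gr n p} (h : LogDefined (base hp) P) :
    gyroNorm hp κ (symmetry hp P) = gyroNorm hp κ P := by
  rw [gyroNorm, gyroNorm, gyroInner, gyroInner, logMap_symmetry h, metric_neg_neg]

theorem gyroAdd_eq_base_iff {hp : p ≤ n} {P Q : Gr n p} (hP : LogDefined (base hp) P)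
    (hQ : LogDefined (base hp) Q) : gyroAdd hp P Q = base hp ↔ P = symmetry hp Q := by
  have hX := hP.isShortest_logMap
  have hs : (symmetry hp P).mat = exp (-generator (base hp) (logMap (base hp) P)) *
      (base hp).mat * exp (generator (base hp) (logMap (base hp) P)) := by
    nth_rewrite 1 [← hX.2.1]
    rw [symmetry_expMap hp hX.1, mat_expMap (neg_mem hX.1), generator_neg, neg_neg]
  -- Solve exp(G) Q exp(-G) = I for Q: the solution is Exp_I(-Log_I P) = s(P).
  have key : gyroAdd hp P Q = base hp ↔ symmetry hp P = Q := by
    rw [← mat_injective.eq_iff, ← mat_injective.eq_iff, mat_gyroAdd hp hP hQ, hs]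
    set G := generator (base hp) (logMap (base hp) P)
    constructor <;> intro h <;> rw [← h]
    · rw [show exp (-G) * (exp G * Q.mat * exp (-G)) * exp G
        = (exp (-G) * exp G) * Q.mat * (exp (-G) * exp G) by noncomm_ring, exp_neg_mul_exp,
        one_mul, mul_one]
    · rw [show exp G * (exp (-G) * (base hp).mat * exp G) * exp (-G)
        = (exp G * exp (-G)) * (base hp).mat * (exp G * exp (-G)) by noncomm_ring,
        exp_mul_exp_neg, one_mul, mul_one]
  rw [key]
  constructor <;> rintro rfl <;> rw [symmetry_symmetry]

end Gr

theorem mainTheorem8 (n p : ℕ) (hp : p ≤ n) (κ : ℝ) (hκ : 0 < κ) :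
    (∀ P : Gr n p, Gr.LogDefined (Gr.base hp) P →
      Gr.LogDefined (Gr.base hp) (Gr.gyroInv hp P) ∧
      Gr.gyroAdd hp (Gr.gyroInv hp P) P = Gr.base hp ∧
      ∀ X : Gr n p, Gr.LogDefined (Gr.base hp) X →
        Gr.gyroAdd hp X P = Gr.base hp → X = Gr.gyroInv hp P) ∧
    Gr.IsGyroisometry hp κ (fun P : Gr n p => Gr.gyroInv hp P) := by
  refine ⟨fun P hP => ?_, ?_⟩
  · rw [Gr.gyroInv_eq_symmetry hP]
    exact ⟨hP.symmetry, (Gr.gyroAdd_eq_base_iff hP.symmetry hP).2 rfl,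
      fun X hX h => (Gr.gyroAdd_eq_base_iff hX hP).1 h⟩
  · rintro P Q ⟨hP, hQ, hPQ⟩
    beta_reduce
    have hadd : Gr.gyroAdd hp (Gr.gyroInv hp (Gr.gyroInv hp P)) (Gr.gyroInv hp Q)
        = Gr.symmetry hp (Gr.gyroAdd hp (Gr.gyroInv hp P) Q) := by
      rw [Gr.gyroInv_eq_symmetry hP, Gr.gyroInv_eq_symmetry hQ, Gr.gyroInv_eq_symmetry hP.symmetry,
        Gr.gyroAdd_symmetry_symmetry hP.symmetry hQ]
    refine ⟨⟨?_, ?_, ?_⟩, ?_⟩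
    · rw [Gr.gyroInv_eq_symmetry hP]
      exact hP.symmetry
    · rw [Gr.gyroInv_eq_symmetry hQ]
      exact hQ.symmetry
    · exact hadd ▸ hPQ.symmetry
    · rw [Gr.gyroDist, Gr.gyroDist, hadd, Gr.gyroNorm_symmetry κ hPQ]
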